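/- **Lemma 4.2 (Reflection lemma).** For $z\in\mathbb R$ let $\mathrm{Ai}(z)=\frac1{2\pi i}\int e^{w^3/3-zw}\,dw$, along the two rays from $e^{-i\pi/3}\infty$ through $0$ to $e^{i\pi/3}\infty$, be the Airy function. For $x\in\mathbb R$ let $S_x=\exp\{x\partial^2+\tfrac13\partial^3\}$ be the operator with integral kernel $$S_x(u,v)=e^{\frac23x^3+x(v-u)}\,\mathrm{Ai}(v-u+x^2),$$ acting on $L^2(a,\infty)$ for any fixed $a>-\infty$, and let $S=S_0$. Let $B(y)$, $y\ge0$, be a Brownian motion with diffusion coefficient $2$ (that is, $B(y)-B(0)$ has variance $2y$). For an upper semicontinuous $h:[0,\infty)\to[-\infty,\infty)$ of at most linear growth let $\tau=\inf\{y\ge0: B(y)\le h(y)\}$, and let $S_x^{\mathrm{hypo}(h)}$ be the operator with integral kernel $$S_x^{\mathrm{hypo}(h)}(u,v)=\mathbb E\big[S_{x-\tau}(B(\tau),v)\,\mathbf 1_{\{\tau<\infty\}}\,\big|\,B(0)=u\big],\qquad S^{\mathrm{hypo}(h)}=S_0^{\mathrm{hypo}(h)}.$$ Let $M_\beta f(x)=e^{\beta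 x}f(x)$, $Rf(x)=f(-x)$, $\chi_0f(x)=\mathbf 1_{\{x>0\}}f(x)$ and $\bar\chi_0=I-\chi_0$. Let $\beta\in\mathbb R$ and $h^+_\beta(y)=2\beta y$ for $y\ge0$. Then $$S^{\mathrm{hypo}(h^+_\beta)}=\chi_0\,(M_\beta RM_{-\beta})\,S+\bar\chi_0\,S.$$ That is, for all $u,v\in\mathbb R$ the random variable in the definition of $S^{\mathrm{hypo}(h^+_\beta)}(u,v)$ is integrable and the kernels of the two sides agree at $(u,v)$ (the right-hand side applies the operators to $S(\cdot,v)$); and for every $a\in\mathbb R$ and real-valued $f\in L^2(a,\infty)$ the integrals over $(a,\infty)$ that define $Sf(u)$ and $S^{\mathrm{hypo}(h^+_\beta)}f(u)$ converge absolutely for every $u\in\mathbb R$, and $$S^{\mathrm{hypo}(h^+_\beta)}f=\chi_0M_\beta RM_{-\beta}(Sf)+\bar\chi_0\,Sf\quad\text{everywhere on }\mathbb R.$$ -/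

import Mathlib

open MeasureTheory ProbabilityTheory Set
open scoped NNReal ENNReal

namespace HitOp

noncomputable section

/-- The ray `s ↦ s e^{iθ}`, `s ≥ 0`, in the complex plane. -/
def ray (θ s : ℝ) : ℂ := (s : ℂ) * Complex.exp (θ * Complex.I)

/-- The integral of `e^{w³/3 - z w} dw` along the ray of angle `θ`, oriented from `0` to
`e^{iθ} ∞`. -/
def rayIntegral (θ z : ℝ) : ℂ :=
  ∫ s in Ioi (0 : ℝ),
    Complex.exp (ray θ s ^ 3 / 3 - z * ray θ s) * Complex.exp (θ * Complex.I)

/-- The contour integral `(1 / 2πi) ∮ e^{w³/3 - z w} dw` along the two rays that go from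
`e^{-iπ/3} ∞` to `0` and from `0` to `e^{iπ/3} ∞`. -/
def airyContour (z : ℝ) : ℂ :=
  (2 * Real.pi * Complex.I)⁻¹ * (rayIntegral (Real.pi / 3) z - rayIntegral (-(Real.pi / 3)) z)

/-- The Airy function on the real line. The contour integral is real there, see
`ofReal_airy`. -/
def airy (z : ℝ) : ℝ := (airyContour z).re

theorem conj_rayIntegral (θ z : ℝ) :
    (starRingEnd ℂ) (rayIntegral θ z) = rayIntegral (-θ) z := by
  unfold rayIntegral ray
  rw [← integral_conj]
  simp [← Complex.exp_conj, map_ofNat]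

theorem ofReal_airy (z : ℝ) : (airy z : ℂ) = airyContour z := by
  refine Complex.conj_eq_iff_re.mp ?_
  unfold airyContour
  rw [map_mul, map_sub, conj_rayIntegral, conj_rayIntegral, neg_neg]
  simp only [map_inv₀, map_mul, Complex.conj_ofReal, Complex.conj_I, map_ofNat]
  rw [mul_neg, inv_neg]
  ring

/-- The integral kernel `S_x(u, v) = e^{2x³/3 + x(v-u)} Ai(v - u + x²)` of the operator
`S_x = exp (x ∂² + ∂³/3)`. -/
def S (x u v : ℝ) : ℝ :=
  Real.exp (2 / 3 * x ^ 3 + x * (v - u)) * airy (v - u + x ^ 2)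

/-- The first time `τ = inf {y ≥ 0 : b y ≤ h y}` at which the path `b` is in the hypograph
of `h : [0, ∞) → [-∞, ∞)`; it is `∞` if there is no such time. -/
def hitTime (h : ℝ≥0 → EReal) (b : ℝ≥0 → ℝ) : ℝ≥0∞ :=
  ⨅ y ∈ {y : ℝ≥0 | (b y : EReal) ≤ h y}, (y : ℝ≥0∞)

variable {Ω : Type*}

/-- For a standard Brownian motion `W`, the Brownian motion with diffusion coefficient 2
(variance `2y` at time `y`) that starts from `u`. -/
def brownianFrom (W : ℝ≥0 → Ω → ℝ) (u : ℝ) (y : ℝ≥0) (ω : Ω) : ℝ :=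
  u + Real.sqrt 2 * W y ω

open Classical in
/-- The random variable `S_{x-τ}(B(τ), v) 1_{τ < ∞}` with `B(0) = u`. -/
def hypoIntegrand (W : ℝ≥0 → Ω → ℝ) (h : ℝ≥0 → EReal) (x u v : ℝ) (ω : Ω) : ℝ :=
  let B : ℝ≥0 → ℝ := fun y => brownianFrom W u y ω
  let τ : ℝ≥0∞ := hitTime h B
  if τ < ∞ then S (x - τ.toReal) (B τ.toNNReal) v else 0

/-- The integral kernel `S_x^{hypo(h)}(u, v) = E[S_{x-τ}(B(τ), v) 1_{τ < ∞} | B(0) = u]`. -/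
def hypoKernel [MeasurableSpace Ω] (P : Measure Ω) (W : ℝ≥0 → Ω → ℝ) (h : ℝ≥0 → EReal)
    (x u v : ℝ) : ℝ :=
  ∫ ω, hypoIntegrand W h x u v ω ∂P

/-- The half-line boundary `h(y) = 2 β y`, `y ≥ 0`. -/
def lineBoundary (β : ℝ) (y : ℝ≥0) : EReal := ((2 * β * (y : ℝ) : ℝ) : EReal)

/-- The operator with integral kernel `K` on functions on `(a, ∞)`:
`(K f)(u) = ∫_a^∞ K(u, v) f(v) dv`. -/
def kernelOp (K : ℝ → ℝ → ℝ) (a : ℝ) (f : ℝ → ℝ) (u : ℝ) : ℝ :=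
  ∫ v in Ioi a, K u v * f v

/-- The multiplication operator `M_β f(x) = e^{β x} f(x)`. -/
def M (β : ℝ) : Module.End ℝ (ℝ → ℝ) where
  toFun f x := Real.exp (β * x) * f x
  map_add' f g := by ext x; simp [mul_add]
  map_smul' c f := by ext x; simp [mul_left_comm]

/-- The reflection operator `R f(x) = f(-x)`. -/
def R : Module.End ℝ (ℝ → ℝ) where
  toFun f x := f (-x)
  map_add' _ _ := rfl
  map_smul' _ _ := rfl

open Classical in
/-- The projection `χ_a` onto functions on `(a, ∞)`: multiplication by `1_{u > a}`. -/
def χ (a : ℝ) : Module.End ℝ (ℝ → ℝ) where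
  toFun f u := if a < u then f u else 0
  map_add' f g := by ext u; by_cases h : a < u <;> simp [h]
  map_smul' c f := by ext u; by_cases h : a < u <;> simp [h]

/-- The complementary projection `1 - χ_a`. -/
def χbar (a : ℝ) : Module.End ℝ (ℝ → ℝ) := 1 - χ a

end

end HitOp

/-!
Below the line, `u ≤ 0`, the hitting time `τ` is zero and there is nothing to prove. Above it,
`u > 0`, the path is on the line at time `τ`, so the random variable is `S_{-τ}(2βτ, v)` and the
claim is `E [S_{-τ}(2βτ, v); τ < ∞] = e^{2βu} Ai(v + u)`.

The contour of the Airy function may be moved to the two diagonal rays `b + s (1 ± i)` from any real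
point `b` (`airy_eq_im_diagIntegral`; by symmetry the upper ray suffices, and the real segment
between the starting points drops out). Moving it by `τ` absorbs the prefactor of `S_{-τ}`:
`S_{-τ}(2βτ, v)` is the contour integral of `e^{p³/3 - vp} e^{-λτ}` with `λ = p² - 2βp`
(`S_eq_im_integral`). If the rays start far enough to the right, `Re λ > 0` on all of them, so the
integrand is dominated by `|e^{p³/3 - vp}|` and Fubini's theorem applies. What remains is the Laplace
transform of the hitting time, `E [e^{-λτ}; τ < ∞] = e^{-ru}`, where `r = p - 2β` solves
`r² + 2βr = λ` (`integral_exp_lineHit`); the factor `e^{-(p - 2β)u}` turns `v` into `v + u` and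
produces `e^{2βu}`.

The Laplace transform is optional stopping for the martingale `exp (-r (B(t) - 2βt) - λt)`, which is
bounded by one up to time `τ`. For continuous time it is proved by stopping at the first point of a
grid of mesh `T / N` at or after `τ`. There the martingale is no longer bounded, but its second
moment is, uniformly in `N` (`integral_sq_stopped_le`), and this is enough to let `N → ∞`
(`integral_eq_of_tendsto_of_sq_bound`).

On `L²(a, ∞)` the integrals converge because `Ai` decays exponentially at `+∞`
(`exists_abs_airy_le`).
-/

namespace HitOp

open Filter Topology Complex

/-! ### The Airy integral along shifted diagonal rays -/

/-- The integrand `e^{w³/3 - z w}` of the contour integral for the Airy function, as an entire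
function of `w`. -/
noncomputable def airyExp (z : ℝ) (w : ℂ) : ℂ := cexp (w ^ 3 / 3 - z * w)

/-- The diagonal ray `s ↦ b + s (1 + i)`. Its direction has argument `π/4`: steep enough for
`e^{w³/3}` to decay along it, and flat enough for `Re (w - x)² ≥ (b - x)²` for real `x ≤ b`. -/
noncomputable def diag (b s : ℝ) : ℂ := b + s * (1 + I)

/-- The integral of `e^{w³/3 - z w} dw` along the diagonal ray that starts from `b`. -/
noncomputable def diagIntegral (b z : ℝ) : ℂ :=
  ∫ s in Ioi (0 : ℝ), airyExp z (diag b s) * (1 + I)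

theorem continuous_airyExp (z : ℝ) : Continuous (airyExp z) := by
  unfold airyExp; fun_prop

theorem continuous_diag (b : ℝ) : Continuous (diag b) := by
  unfold diag; fun_prop

theorem norm_airyExp (z : ℝ) (w : ℂ) :
    ‖airyExp z w‖ = Real.exp (w.re * (w.re ^ 2 / 3 - w.im ^ 2 - z)) := by
  have hw : w ^ 3 / 3 - z * w =
      ((w.re * (w.re ^ 2 / 3 - w.im ^ 2 - z) : ℝ) : ℂ) +
        ((w.im * (w.re ^ 2 - w.im ^ 2 / 3 - z) : ℝ) : ℂ) * I := by
    conv_lhs => rw [← re_add_im w]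
    push_cast
    linear_combination ((w.im : ℂ) ^ 3 / 3 * I + (w.re : ℂ) * w.im ^ 2) * I_sq
  rw [airyExp, norm_exp, hw, add_re, re_ofReal_mul, ofReal_re, I_re, mul_zero, add_zero]

theorem norm_airyExp_diag (z b s : ℝ) :
    ‖airyExp z (diag b s)‖ =
      Real.exp (b ^ 3 / 3 - z * b) * Real.exp (-(2 / 3) * s ^ 3 + (b ^ 2 - z) * s) := by
  rw [norm_airyExp, ← Real.exp_add]
  simp only [diag, add_re, ofReal_re, mul_re, one_re, I_re, add_im, one_im, I_im, ofReal_im, mul_im]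
  ring_nf

theorem integrableOn_exp_cubic {κ : ℝ} (hκ : 0 < κ) (A : ℝ) :
    IntegrableOn (fun s : ℝ => Real.exp (-κ * s ^ 3 + A * s)) (Ioi 0) := by
  set D : ℝ := |A| + 1 with hD
  have hD1 : 0 < D := by positivity
  have hint : IntegrableOn (fun s : ℝ => Real.exp (D * (1 + D / κ)) * Real.exp (-s)) (Ioi 0) :=
    (integrableOn_exp_neg_Ioi 0).const_mul _
  refine hint.mono' (by fun_prop : Continuous _).aestronglyMeasurable.restrict ?_
  filter_upwards [ae_restrict_mem measurableSet_Ioi] with s hs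
  have hs0 : 0 < s := hs
  rw [Real.norm_eq_abs, Real.abs_exp, ← Real.exp_add]
  refine Real.exp_le_exp.mpr ?_
  have hA : A * s ≤ (D - 1) * s := by
    have := le_abs_self A
    gcongr
    linarith
  -- either the cubic term beats `D s`, or `s` is at most `1 + D / κ`
  have key : D * s ≤ κ * s ^ 3 + D * (1 + D / κ) := by
    rcases le_total s (1 + D / κ) with h | h
    · have : 0 ≤ κ * s ^ 3 := by positivity
      nlinarith
    · have h1 : 1 ≤ s := by
        have : 0 ≤ D / κ := by positivity
        linarith
      have h2 : D ≤ κ * s := by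
        have : D / κ ≤ s := by linarith
        rw [div_le_iff₀ hκ] at this
        linarith
      have h3 : κ * s * s ≤ κ * s ^ 3 := by
        have : s ^ 2 ≤ s ^ 3 := pow_le_pow_right₀ h1 (by norm_num)
        nlinarith
      have h4 : D * s ≤ κ * s * s := by gcongr
      have : 0 ≤ D * (1 + D / κ) := by positivity
      linarith
  linarith

theorem integrableOn_airyExp_diag (z b : ℝ) :
    IntegrableOn (fun s => airyExp z (diag b s) * (1 + I)) (Ioi 0) := by
  refine Integrable.mul_const ?_ _
  have hc : Continuous fun s => airyExp z (diag b s) :=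
    (continuous_airyExp z).comp (continuous_diag b)
  refine ((integrableOn_exp_cubic (κ := 2 / 3) (by norm_num) (b ^ 2 - z)).const_mul
    (Real.exp (b ^ 3 / 3 - z * b))).mono' hc.aestronglyMeasurable.restrict ?_
  exact Eventually.of_forall fun s => (norm_airyExp_diag z b s).le

theorem exp_pi_div_three_mul_I :
    cexp ((Real.pi / 3 : ℝ) * I) = ((1 / 2 : ℝ) : ℂ) + ((√3 / 2 : ℝ) : ℂ) * I := by
  rw [exp_mul_I, ← ofReal_cos, ← ofReal_sin, Real.cos_pi_div_three, Real.sin_pi_div_three]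

theorem integrableOn_airyExp_ray (z : ℝ) :
    IntegrableOn (fun s => airyExp z (ray (Real.pi / 3) s) * cexp ((Real.pi / 3 : ℝ) * I))
      (Ioi 0) := by
  refine Integrable.mul_const ?_ _
  have hc : Continuous fun s => airyExp z (ray (Real.pi / 3) s) :=
    (continuous_airyExp z).comp (by unfold ray; fun_prop)
  refine (integrableOn_exp_cubic (κ := 1 / 3) (by norm_num) (-z / 2)).mono'
    hc.aestronglyMeasurable.restrict ?_
  refine Eventually.of_forall fun s => ?_
  rw [norm_airyExp, ray, exp_pi_div_three_mul_I]
  refine le_of_eq (congrArg _ ?_)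
  have h3 : √3 ^ 2 = 3 := Real.sq_sqrt (by norm_num)
  simp only [mul_re, mul_im, add_re, add_im, ofReal_re, ofReal_im, I_re, I_im]
  ring_nf
  rw [h3]
  ring

/-- `e^{w³/3 - z w}` has a primitive on every disc, so that its integrals over polygonal paths
depend on the end points only. -/
theorem exists_primitive_airyExp (z r : ℝ) :
    ∃ G : ℂ → ℂ, ∀ w ∈ Metric.ball (0 : ℂ) r, HasDerivAt G (airyExp z w) w := by
  have hd : DifferentiableOn ℂ (airyExp z) (Metric.ball 0 r) := by
    unfold airyExp; fun_prop
  exact hd.isExactOn_ball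

theorem integral_along_segment {F G : ℂ → ℂ} {p d : ℂ} {T : ℝ} (hF : Continuous F)
    (hG : ∀ s ∈ uIcc 0 T, HasDerivAt G (F (p + s * d)) (p + s * d)) :
    ∫ s in (0 : ℝ)..T, F (p + s * d) * d = G (p + T * d) - G p := by
  have h := intervalIntegral.integral_eq_sub_of_hasDerivAt
    (f := fun s : ℝ => G (p + s * d)) (f' := fun s : ℝ => F (p + s * d) * d) (a := 0) (b := T)
    (fun s hs => by
      have h1 : HasDerivAt (fun s : ℝ => p + (s : ℂ) * d) d s := by
        simpa using ((ofRealCLM.hasDerivAt (x := s)).mul_const d).const_add p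
      exact (hG s hs).comp s h1)
    (Continuous.intervalIntegrable (by fun_prop) _ _)
  simpa using h

/-- The chord from `T e^{iπ/3}` to `b + T (1 + i)` lies in a rectangle on which the Airy integrand
is at most `e^{-T/4}`. -/
theorem norm_airyExp_le_on_rectangle {z T : ℝ} {w : ℂ} (hT : 1 ≤ T)
    (hz : 10 * (1 + |z|) ≤ T) (hre1 : T / 4 ≤ w.re) (hre2 : w.re ≤ 5 / 4 * T)
    (him : 4 / 5 * T ≤ w.im) : ‖airyExp z w‖ ≤ Real.exp (-(T / 4)) := by
  rw [norm_airyExp]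
  refine Real.exp_le_exp.mpr ?_
  have h1 : w.re ^ 2 ≤ (5 / 4 * T) ^ 2 := by
    have : 0 ≤ w.re := by linarith
    gcongr
  have h2 : (4 / 5 * T) ^ 2 ≤ w.im ^ 2 := by gcongr
  have h3 : 10 * (1 + |z|) * 1 ≤ T * T := by gcongr
  have h4 : w.re ^ 2 / 3 - w.im ^ 2 - z ≤ -1 := by
    have := neg_abs_le z
    nlinarith
  nlinarith

theorem sqrt_three_div_two_bounds : 4 / 5 ≤ √3 / 2 ∧ √3 / 2 ≤ 1 := by
  constructor
  · have : (8 / 5 : ℝ) ≤ √3 := Real.le_sqrt_of_sq_le (by norm_num)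
    linarith
  · have : √3 ≤ 2 := Real.sqrt_le_iff.mpr (by norm_num)
    linarith

/-- The contour along the ray of argument `π/3` from `0` may be replaced by the real segment from
`0` to `b` followed by the diagonal ray from `b`. -/
theorem rayIntegral_pi_div_three (z b : ℝ) :
    rayIntegral (Real.pi / 3) z = (∫ s in (0 : ℝ)..b, airyExp z s) + diagIntegral b z := by
  have hray := intervalIntegral_tendsto_integral_Ioi 0 (integrableOn_airyExp_ray z) tendsto_id
  have hdiag := intervalIntegral_tendsto_integral_Ioi 0 (integrableOn_airyExp_diag z b) tendsto_id
  have hdiff := hray.sub hdiag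
  have hlim : Tendsto (fun T : ℝ => Real.exp (-(T / 4)) * (5 * T)) atTop (𝓝 0) := by
    have h := (Real.tendsto_pow_mul_exp_neg_atTop_nhds_zero 1).comp
      (tendsto_id.atTop_div_const (show (0 : ℝ) < 4 by norm_num))
    have h' := h.mul_const 20
    simp only [zero_mul] at h'
    refine h'.congr fun T => ?_
    simp only [Function.comp, id, pow_one]
    ring
  have hconst : Tendsto (fun _ : ℝ => ∫ s in (0 : ℝ)..b, airyExp z s) atTop
      (𝓝 (∫ s in (0 : ℝ)..b, airyExp z s)) := tendsto_const_nhds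
  have hzero : Tendsto (fun T : ℝ =>
      ((∫ s in (0 : ℝ)..id T, airyExp z (ray (Real.pi / 3) s) * cexp ((Real.pi / 3 : ℝ) * I)) -
        ∫ s in (0 : ℝ)..id T, airyExp z (diag b s) * (1 + I)) -
        ∫ s in (0 : ℝ)..b, airyExp z s) atTop (𝓝 0) := by
    refine squeeze_zero_norm' ?_ hlim
    filter_upwards [eventually_ge_atTop (1 : ℝ), eventually_ge_atTop (4 * |b|),
      eventually_ge_atTop (10 * (1 + |z|))] with T hT hb hz
    obtain ⟨G, hG⟩ := exists_primitive_airyExp z (4 * T)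
    set e : ℂ := ((1 / 2 : ℝ) : ℂ) + ((√3 / 2 : ℝ) : ℂ) * I with he
    obtain ⟨hs1, hs2⟩ := sqrt_three_div_two_bounds
    have hnorm : ∀ w : ℂ, |w.re| + |w.im| < 4 * T → w ∈ Metric.ball (0 : ℂ) (4 * T) := by
      intro w hw
      rw [mem_ball_zero_iff]
      exact (norm_le_abs_re_add_abs_im w).trans_lt hw
    have ere : ∀ s : ℝ, (0 + (s : ℂ) * e).re = s * (1 / 2) := by
      intro s; simp [he]
    have eim : ∀ s : ℝ, (0 + (s : ℂ) * e).im = s * (√3 / 2) := by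
      intro s; simp [he]
    have dre : ∀ s : ℝ, ((b : ℂ) + (s : ℂ) * (1 + I)).re = b + s := by intro s; simp
    have dim : ∀ s : ℝ, ((b : ℂ) + (s : ℂ) * (1 + I)).im = s := by intro s; simp
    have hbabs := abs_le.mp (le_refl |b|)
    have I1 : ∫ s in (0 : ℝ)..T, airyExp z (ray (Real.pi / 3) s) * cexp ((Real.pi / 3 : ℝ) * I) =
        G (0 + T * e) - G 0 := by
      rw [← integral_along_segment (F := airyExp z) (continuous_airyExp z) (fun s hs => hG _ ?_)]
      · simp only [ray, exp_pi_div_three_mul_I, zero_add, he]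
      · rw [uIcc_of_le (by linarith)] at hs
        refine hnorm _ ?_
        rw [ere, eim, abs_of_nonneg (by linarith [hs.1]),
          abs_of_nonneg (mul_nonneg hs.1 (by linarith))]
        nlinarith [hs.1, hs.2]
    have I2 : ∫ s in (0 : ℝ)..T, airyExp z (diag b s) * (1 + I) =
        G (b + T * (1 + I)) - G b := by
      rw [← integral_along_segment (F := airyExp z) (continuous_airyExp z) (fun s hs => hG _ ?_)]
      · simp only [diag]
      · rw [uIcc_of_le (by linarith)] at hs
        refine hnorm _ ?_
        rw [dre, dim, abs_of_nonneg hs.1]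
        have := abs_add_le b s
        rw [abs_of_nonneg hs.1] at this
        linarith [hs.1, hs.2]
    have I3 : ∫ s in (0 : ℝ)..b, airyExp z s = G b - G 0 := by
      have h := integral_along_segment (F := airyExp z) (G := G) (p := 0) (d := 1) (T := b)
        (continuous_airyExp z) (fun s hs => hG _ ?_)
      · simpa using h
      · refine hnorm _ ?_
        have : |s| ≤ |b| := by
          rcases mem_uIcc.mp hs with h | h
          · rw [abs_of_nonneg h.1]; linarith [hbabs.2, h.2]
          · rw [abs_of_nonpos h.2]; linarith [hbabs.1, h.1]
        have h0 := abs_nonneg b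
        simp only [zero_add, mul_one, ofReal_re, ofReal_im, abs_zero, add_zero]
        linarith
    simp only [id]
    rw [I1, I2, I3]
    have hid : G (0 + T * e) - G 0 - (G (b + T * (1 + I)) - G b) - (G b - G 0) =
        G (0 + T * e) - G (b + T * (1 + I)) := by ring
    rw [hid]
    set K : Set ℂ := Icc (T / 4) (5 / 4 * T) ×ℂ Icc (4 / 5 * T) T with hK
    have hKc : Convex ℝ K := 
    ((convex_Icc _ _).linear_preimage reLm).inter ((convex_Icc _ _).linear_preimage imLm)
    have hKmem : ∀ w ∈ K, T / 4 ≤ w.re ∧ w.re ≤ 5 / 4 * T ∧ 4 / 5 * T ≤ w.im ∧ w.im ≤ T := by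
      intro w hw
      rw [hK, mem_reProdIm] at hw
      exact ⟨hw.1.1, hw.1.2, hw.2.1, hw.2.2⟩
    have hmv := hKc.norm_image_sub_le_of_norm_hasDerivWithin_le (f := G) (f' := airyExp z)
      (C := Real.exp (-(T / 4))) (x := b + T * (1 + I)) (y := 0 + T * e)
      (fun w hw => by
        obtain ⟨h1, h2, h3, h4⟩ := hKmem w hw
        refine (hG w (hnorm w ?_)).hasDerivWithinAt
        rw [abs_of_nonneg (by linarith), abs_of_nonneg (by linarith)]
        linarith)
      (fun w hw => by
        obtain ⟨h1, h2, h3, h4⟩ := hKmem w hw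
        exact norm_airyExp_le_on_rectangle hT hz h1 h2 h3)
      (by
        rw [hK, mem_reProdIm, dre, dim]
        refine ⟨⟨?_, ?_⟩, ⟨?_, ?_⟩⟩ <;> linarith [hbabs.1, hbabs.2])
      (by
        rw [hK, mem_reProdIm, ere, eim]
        refine ⟨⟨?_, ?_⟩, ⟨?_, ?_⟩⟩ <;> nlinarith)
    refine hmv.trans ?_
    gcongr
    refine (norm_le_abs_re_add_abs_im _).trans ?_
    rw [sub_re, sub_im, ere, eim, dre, dim]
    have h1 : |T * (1 / 2) - (b + T)| ≤ 2 * T := by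
      rw [abs_le]; constructor <;> linarith [hbabs.1, hbabs.2]
    have h2 : |T * (√3 / 2) - T| ≤ 2 * T := by
      rw [abs_le]; constructor <;> nlinarith
    linarith
  have huniq := tendsto_nhds_unique hzero (hdiff.sub hconst)
  have hR : rayIntegral (Real.pi / 3) z =
      ∫ s in Ioi (0 : ℝ), airyExp z (ray (Real.pi / 3) s) * cexp ((Real.pi / 3 : ℝ) * I) := rfl
  rw [hR, diagIntegral]
  linear_combination -huniq

/-- The Airy function as an integral along the diagonal ray from an arbitrary real point `b`: the
segment from `0` to `b` contributes a real number, and only the imaginary part counts. -/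
theorem airy_eq_im_diagIntegral (b z : ℝ) : airy z = (diagIntegral b z).im / Real.pi := by
  have hreal : ∀ s : ℝ, airyExp z s = ((Real.exp (s ^ 3 / 3 - z * s) : ℝ) : ℂ) := by
    intro s; simp [airyExp]
  have hseg : (∫ s in (0 : ℝ)..b, airyExp z s).im = 0 := by
    simp_rw [hreal]
    rw [intervalIntegral.integral_ofReal, ofReal_im]
  have h1 : rayIntegral (Real.pi / 3) z - rayIntegral (-(Real.pi / 3)) z =
      ((2 * (diagIntegral b z).im : ℝ) : ℂ) * I := by
    rw [← conj_rayIntegral, sub_conj, rayIntegral_pi_div_three z b, add_im, hseg, zero_add]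
  rw [airy, airyContour, h1]
  have h2 : (2 * (Real.pi : ℂ) * I)⁻¹ * (((2 * (diagIntegral b z).im : ℝ) : ℂ) * I) =
      (((diagIntegral b z).im / Real.pi : ℝ) : ℂ) := by
    have : (Real.pi : ℂ) ≠ 0 := ofReal_ne_zero.mpr Real.pi_ne_zero
    push_cast
    field_simp
  rw [h2, ofReal_re]

theorem measurable_airy : Measurable airy := by
  have h : StronglyMeasurable fun z : ℝ => diagIntegral 0 z := by
    unfold diagIntegral
    refine StronglyMeasurable.integral_prod_right
      (f := fun z s : ℝ => airyExp z (diag 0 s) * (1 + I)) ?_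
    refine Continuous.stronglyMeasurable ?_
    unfold airyExp diag Function.uncurry
    fun_prop
  have h' : airy = fun z => (diagIntegral 0 z).im / Real.pi :=
    funext fun z => airy_eq_im_diagIntegral 0 z
  rw [h']
  exact (measurable_im.comp h.measurable).div_const _

/-- The Airy function decays exponentially on every half-line `[a, ∞)`: shift the contour
to `b = 1`. -/
theorem exists_abs_airy_le (a : ℝ) : ∃ C, ∀ z, a ≤ z → |airy z| ≤ C * Real.exp (-z) := by
  set J := ∫ s in Ioi (0 : ℝ), Real.exp (-(2 / 3) * s ^ 3 + (1 - a) * s) with hJ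
  refine ⟨Real.exp (1 / 3) * J * ‖(1 + I : ℂ)‖ / Real.pi, fun z hz => ?_⟩
  rw [airy_eq_im_diagIntegral 1 z, abs_div, abs_of_pos Real.pi_pos, div_mul_eq_mul_div]
  gcongr
  refine (abs_im_le_norm _).trans ?_
  have hb := norm_integral_le_of_norm_le (μ := volume.restrict (Ioi (0 : ℝ)))
    (f := fun s => airyExp z (diag 1 s) * (1 + I))
    (g := fun s => Real.exp (1 / 3 - z) * ‖(1 + I : ℂ)‖ *
      Real.exp (-(2 / 3) * s ^ 3 + (1 - a) * s))
    ((integrableOn_exp_cubic (by norm_num) _).const_mul _) (by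
      filter_upwards [ae_restrict_mem measurableSet_Ioi] with s hs
      have hs0 : 0 < s := hs
      rw [norm_mul, norm_airyExp_diag, mul_right_comm]
      have h1 : (1 : ℝ) ^ 3 / 3 - z * 1 = 1 / 3 - z := by ring
      rw [h1]
      gcongr
      linarith)
  refine hb.trans (le_of_eq ?_)
  rw [integral_const_mul, ← hJ, sub_eq_add_neg, Real.exp_add]
  ring

/-- `Ai` is square integrable on every half-line, so that its products with functions
in `L²(a, ∞)` are integrable. -/
theorem integrableOn_airy_sub_mul {a : ℝ} {f : ℝ → ℝ} (hf : MemLp f 2 (volume.restrict (Ioi a)))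
    (u : ℝ) : IntegrableOn (fun v => airy (v - u) * f v) (Ioi a) := by
  obtain ⟨C, hC⟩ := exists_abs_airy_le (a - u)
  have hmeas : Measurable fun v => airy (v - u) := measurable_airy.comp (measurable_sub_const u)
  have hL2 : MemLp (fun v => airy (v - u)) 2 (volume.restrict (Ioi a)) := by
    rw [memLp_two_iff_integrable_sq hmeas.aestronglyMeasurable]
    have hint : IntegrableOn (fun v : ℝ => (C * Real.exp u) ^ 2 * Real.exp (-2 * v)) (Ioi a) :=
      (integrableOn_exp_mul_Ioi (by norm_num) a).const_mul _
    refine hint.mono' (hmeas.pow_const 2).aestronglyMeasurable ?_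
    filter_upwards [ae_restrict_mem measurableSet_Ioi] with v hv
    have h := hC (v - u) (by have : a < v := hv; linarith)
    have h2 : (C * Real.exp u) ^ 2 * Real.exp (-2 * v) = (C * Real.exp (-(v - u))) ^ 2 := by
      rw [mul_pow, mul_pow, mul_assoc, ← Real.exp_nat_mul, ← Real.exp_nat_mul, ← Real.exp_add]
      push_cast
      ring_nf
    rw [h2, Real.norm_eq_abs, abs_pow]
    gcongr
  exact hL2.integrable_mul hf

/-! ### The hitting time of a line by a continuous path -/

section Path

variable {β : ℝ} {b : ℝ≥0 → ℝ}

theorem hitTime_lineBoundary_le {t : ℝ≥0} (ht : b t ≤ 2 * β * t) :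
    hitTime (lineBoundary β) b ≤ t := by
  refine iInf₂_le t ?_
  simpa [lineBoundary] using (EReal.coe_le_coe_iff.mpr ht)

/-- A continuous path attains the infimum in the definition of its hitting time. -/
theorem exists_hitTime_eq (hb : Continuous b) (hfin : hitTime (lineBoundary β) b < ∞) :
    ∃ m : ℝ≥0, hitTime (lineBoundary β) b = m ∧ b m ≤ 2 * β * m := by
  set A : Set ℝ≥0 := {y | (b y : EReal) ≤ lineBoundary β y} with hA
  have hAiff : ∀ y, y ∈ A ↔ b y ≤ 2 * β * y := fun y => EReal.coe_le_coe_iff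
  have hAne : A.Nonempty := by
    by_contra h
    rw [Set.not_nonempty_iff_eq_empty] at h
    have : hitTime (lineBoundary β) b = ⊤ := by
      unfold hitTime
      rw [← hA, h]
      simp
    exact hfin.ne this
  have hAcl : IsClosed A := by
    have : A = {y : ℝ≥0 | b y ≤ 2 * β * y} := Set.ext hAiff
    rw [this]
    exact isClosed_le hb (by fun_prop)
  have hmem : sInf A ∈ A := hAcl.csInf_mem hAne (OrderBot.bddBelow A)
  refine ⟨sInf A, le_antisymm (iInf₂_le _ hmem) ?_, (hAiff _).mp hmem⟩
  refine le_iInf₂ fun y hy => ?_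
  exact_mod_cast csInf_le (OrderBot.bddBelow A) hy

theorem lt_hitTime_iff (hb : Continuous b) (y : ℝ≥0) :
    (y : ℝ≥0∞) < hitTime (lineBoundary β) b ↔ ∀ t ≤ y, 2 * β * t < b t := by
  constructor
  · intro h t ht
    by_contra hle
    have h1 := hitTime_lineBoundary_le (not_lt.mp hle)
    exact absurd (h.trans_le h1) (not_lt.mpr (by exact_mod_cast ht))
  · intro h
    by_contra hle
    rw [not_lt] at hle
    obtain ⟨m, hm, hbm⟩ := exists_hitTime_eq hb (hle.trans_lt ENNReal.coe_lt_top)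
    rw [hm] at hle
    exact absurd (h m (by exact_mod_cast hle)) (not_lt.mpr hbm)

/-- A path that starts above the line is on the line at its hitting time. -/
theorem apply_hitTime (hb : Continuous b) (h0 : 0 < b 0)
    (hfin : hitTime (lineBoundary β) b < ∞) :
    b (hitTime (lineBoundary β) b).toNNReal = 2 * β * (hitTime (lineBoundary β) b).toNNReal := by
  obtain ⟨m, hm, hbm⟩ := exists_hitTime_eq hb hfin
  rw [hm, ENNReal.toNNReal_coe]
  have hc : ContinuousOn (fun t : ℝ≥0 => b t - 2 * β * t) (Icc 0 m) := by fun_prop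
  obtain ⟨t, ht, hbt⟩ := intermediate_value_Icc' (zero_le : (0 : ℝ≥0) ≤ m) hc
    (show (0 : ℝ) ∈ Icc _ _ from ⟨by linarith, by simpa using h0.le⟩)
  have h1 : b t = 2 * β * t := by simpa [sub_eq_zero] using hbt
  have h2 := hitTime_lineBoundary_le h1.le
  rw [hm] at h2
  have h3 : t = m := le_antisymm ht.2 (by exact_mod_cast h2)
  rw [← h3, h1]

theorem le_of_le_hitTime (hb : Continuous b) (h0 : 0 < b 0) {t : ℝ≥0}
    (ht : (t : ℝ≥0∞) ≤ hitTime (lineBoundary β) b) : 2 * β * t ≤ b t := by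
  rcases ht.lt_or_eq with h | h
  · exact ((lt_hitTime_iff hb t).mp h t le_rfl).le
  · have h1 := apply_hitTime (β := β) hb h0 (by rw [← h]; exact ENNReal.coe_lt_top)
    rw [← h, ENNReal.toNNReal_coe] at h1
    exact h1.ge

/-- Positivity of a continuous function on `[0, y]` can be read off from a countable dense set. -/
theorem lt_hitTime_iff_denseSeq (hb : Continuous b) (y : ℝ≥0) :
    (y : ℝ≥0∞) < hitTime (lineBoundary β) b ↔
      ∃ m : ℕ, ∀ n : ℕ, 1 / ((m : ℝ) + 1) ≤
        b (TopologicalSpace.denseSeq (Iic y) n) -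
          2 * β * ((TopologicalSpace.denseSeq (Iic y) n : ℝ≥0) : ℝ) := by
  rw [lt_hitTime_iff hb]
  have hc : Continuous fun t : Iic y => b t - 2 * β * ((t : ℝ≥0) : ℝ) := by fun_prop
  constructor
  · intro h
    have hcomp : IsCompact (Iic y) := by
      have : Iic y = Icc 0 y := by ext; simp
      rw [this]
      exact isCompact_Icc
    obtain ⟨t, ht, hmin⟩ := hcomp.exists_isMinOn ⟨y, self_mem_Iic⟩
      (f := fun t : ℝ≥0 => b t - 2 * β * t) (by fun_prop)
    obtain ⟨m, hm⟩ := exists_nat_one_div_lt (sub_pos.mpr (h t ht))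
    exact ⟨m, fun n => hm.le.trans (hmin (TopologicalSpace.denseSeq (Iic y) n).2)⟩
  · rintro ⟨m, hm⟩ t ht
    have hcl : IsClosed {t : Iic y | 1 / ((m : ℝ) + 1) ≤ b t - 2 * β * ((t : ℝ≥0) : ℝ)} :=
      isClosed_le continuous_const hc
    have huniv := (TopologicalSpace.denseRange_denseSeq (Iic y)).closure_range
    have hsub : closure (range (TopologicalSpace.denseSeq (Iic y))) ⊆ _ :=
      hcl.closure_subset_iff.mpr (by rintro _ ⟨n, rfl⟩; exact hm n)
    rw [huniv] at hsub
    have h1 : 1 / ((m : ℝ) + 1) ≤ b t - 2 * β * (t : ℝ) := hsub (mem_univ (⟨t, ht⟩ : Iic y))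
    have h2 : 0 < 1 / ((m : ℝ) + 1) := by positivity
    linarith

/-- A time is the supremum of the rational times before it. -/
theorem eq_iSup_indicator (x : ℝ≥0∞) :
    x = ⨆ q : ℚ, if (Real.toNNReal q : ℝ≥0∞) < x then (Real.toNNReal q : ℝ≥0∞) else 0 := by
  refine le_antisymm (le_of_forall_lt fun c hc => ?_) (iSup_le fun q => ?_)
  · obtain ⟨q, -, h1, h2⟩ := ENNReal.lt_iff_exists_rat_btwn.mp hc
    rw [lt_iSup_iff]
    refine ⟨q, ?_⟩
    rw [if_pos h2]
    exact h1
  · split_ifs with h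
    · exact h.le
    · exact zero_le

end Path

/-! ### Grid approximation of a time from the right -/

/-- For a time `τ`, the first point of the grid `δ ℕ` at or after `τ`, or `k δ` if that comes
earlier. -/
noncomputable def gridStop (δ : ℝ≥0) (τ : ℝ≥0∞) : ℕ → ℝ≥0
  | 0 => 0
  | k + 1 => open Classical in
      if ((k * δ : ℝ≥0) : ℝ≥0∞) < τ then (k + 1) * δ else gridStop δ τ k

theorem gridStop_of_lt {δ : ℝ≥0} {τ : ℝ≥0∞} : ∀ {k : ℕ}, ((k * δ : ℝ≥0) : ℝ≥0∞) < τ →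
    gridStop δ τ k = k * δ
  | 0, _ => by simp [gridStop]
  | k + 1, h => by
      have h' : ((k * δ : ℝ≥0) : ℝ≥0∞) < τ := by
        refine lt_of_le_of_lt ?_ h
        push_cast
        gcongr
        exact le_self_add
      rw [gridStop, if_pos h']
      push_cast
      rfl

theorem gridStop_bounds (δ : ℝ≥0) (τ : ℝ≥0∞) (k : ℕ) :
    min τ ((k * δ : ℝ≥0) : ℝ≥0∞) ≤ gridStop δ τ k ∧
      (gridStop δ τ k : ℝ≥0∞) ≤ min τ ((k * δ : ℝ≥0) : ℝ≥0∞) + δ := by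
  induction k with
  | zero => simp [gridStop]
  | succ k ih =>
    by_cases h : ((k * δ : ℝ≥0) : ℝ≥0∞) < τ
    · have hg : gridStop δ τ (k + 1) = k * δ + δ := by
        simp only [gridStop, if_pos h]; ring
      have hk : (((k + 1 : ℕ) * δ : ℝ≥0) : ℝ≥0∞) = ((k * δ : ℝ≥0) : ℝ≥0∞) + δ := by
        rw [← ENNReal.coe_add]; congr 1; push_cast; ring
      rw [hg, hk, ENNReal.coe_add]
      refine ⟨min_le_right _ _, ?_⟩
      gcongr
      exact le_min h.le le_self_add
    · have hg : gridStop δ τ (k + 1) = gridStop δ τ k := by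
        simp only [gridStop, if_neg h]
      rw [not_lt] at h
      have hle : ((k * δ : ℝ≥0) : ℝ≥0∞) ≤ (((k + 1 : ℕ) * δ : ℝ≥0) : ℝ≥0∞) := by
        push_cast
        gcongr
        exact le_self_add
      rw [hg, min_eq_left (h.trans hle), ← min_eq_left h]
      rw [min_eq_left h] at ih ⊢
      exact ih

theorem tendsto_gridStop (T : ℝ≥0) (τ : ℝ≥0∞) :
    Tendsto (fun N : ℕ => gridStop (T / (N + 1)) τ (N + 1)) atTop (𝓝 (min τ T).toNNReal) := by
  have hT : ∀ N : ℕ, ((N + 1 : ℕ) : ℝ≥0) * (T / (N + 1)) = T := by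
    intro N
    have : (N : ℝ≥0) + 1 ≠ 0 := by positivity
    push_cast
    field_simp
  have hfin : min τ (T : ℝ≥0∞) ≠ ∞ := (min_le_right _ _).trans_lt ENNReal.coe_lt_top |>.ne
  have hδ : Tendsto (fun N : ℕ => (min τ (T : ℝ≥0∞)).toNNReal + T / ((N : ℝ≥0) + 1)) atTop
      (𝓝 ((min τ (T : ℝ≥0∞)).toNNReal + 0)) := by
    refine tendsto_const_nhds.add ?_
    rw [← NNReal.tendsto_coe]
    push_cast
    have := (tendsto_one_div_add_atTop_nhds_zero_nat (𝕜 := ℝ)).const_mul (T : ℝ)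
    simpa [div_eq_mul_inv] using this
  rw [add_zero] at hδ
  refine tendsto_of_tendsto_of_tendsto_of_le_of_le tendsto_const_nhds hδ (fun N => ?_) fun N => ?_
  · have h := (gridStop_bounds (T / (N + 1)) τ (N + 1)).1
    rw [hT, ← ENNReal.coe_toNNReal hfin] at h
    exact_mod_cast h
  · have h := (gridStop_bounds (T / (N + 1)) τ (N + 1)).2
    rw [hT, ← ENNReal.coe_toNNReal hfin] at h
    exact_mod_cast h

/-! ### Limits of integrals under a second moment bound -/

/-- Truncation of a complex number at modulus `K`. -/
noncomputable def clip (K : ℝ) (z : ℂ) : ℂ := ((K / max K ‖z‖ : ℝ) : ℂ) * z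

theorem continuous_clip {K : ℝ} (hK : 0 < K) : Continuous (clip K) := by
  unfold clip
  have : ∀ z : ℂ, max K ‖z‖ ≠ 0 := fun z => (hK.trans_le (le_max_left _ _)).ne'
  fun_prop (disch := exact this _)

theorem norm_clip_le {K : ℝ} (hK : 0 < K) (z : ℂ) : ‖clip K z‖ ≤ K := by
  have hm : 0 < max K ‖z‖ := hK.trans_le (le_max_left _ _)
  rw [clip, norm_mul, norm_real, Real.norm_of_nonneg (by positivity), div_mul_eq_mul_div,
    div_le_iff₀ hm]
  gcongr
  exact le_max_right _ _

theorem clip_of_norm_le {K : ℝ} (hK : 0 < K) {z : ℂ} (hz : ‖z‖ ≤ K) : clip K z = z := by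
  rw [clip, max_eq_left hz, div_self hK.ne', ofReal_one, one_mul]

theorem norm_sub_clip_le {K : ℝ} (hK : 0 < K) (z : ℂ) : ‖z - clip K z‖ ≤ ‖z‖ ^ 2 / K := by
  rcases le_total ‖z‖ K with h | h
  · rw [clip_of_norm_le hK h, sub_self, norm_zero]
    positivity
  · have hz : 0 < ‖z‖ := hK.trans_le h
    have h1 : z - clip K z = ((1 - K / ‖z‖ : ℝ) : ℂ) * z := by
      rw [clip, max_eq_right h]; push_cast; ring
    have h2 : 0 ≤ 1 - K / ‖z‖ := by rw [sub_nonneg, div_le_one hz]; exact h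
    rw [h1, norm_mul, norm_real, Real.norm_of_nonneg h2, sub_mul, one_mul, div_mul_cancel₀ _ hz.ne',
      le_div_iff₀ hK]
    nlinarith

/-- If integrals of a sequence with bounded second moments are constant and the sequence converges
almost everywhere to a bounded limit, the limit has the same integral: the truncation at `K` costs
at most `C / K`, uniformly along the sequence. -/
theorem integral_eq_of_tendsto_of_sq_bound {Ω : Type*} [MeasurableSpace Ω] {P : Measure Ω}
    [IsProbabilityMeasure P] {Z : ℕ → Ω → ℂ} {Y : Ω → ℂ} {m : ℂ} {C : ℝ}
    (hZm : ∀ n, AEStronglyMeasurable (Z n) P) (hZi : ∀ n, Integrable (fun ω => ‖Z n ω‖ ^ 2) P)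
    (hZC : ∀ n, ∫ ω, ‖Z n ω‖ ^ 2 ∂P ≤ C) (hm : ∀ n, ∫ ω, Z n ω ∂P = m)
    (hY : ∀ᵐ ω ∂P, ‖Y ω‖ ≤ 1) (hlim : ∀ᵐ ω ∂P, Tendsto (fun n => Z n ω) atTop (𝓝 (Y ω))) :
    ∫ ω, Y ω ∂P = m := by
  have hbound : ∀ K : ℝ, 1 ≤ K → ‖m - ∫ ω, Y ω ∂P‖ ≤ C / K := by
    intro K hK
    have hK0 : 0 < K := by linarith
    have hcm : ∀ n, AEStronglyMeasurable (fun ω => clip K (Z n ω)) P := fun n =>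
      (continuous_clip hK0).comp_aestronglyMeasurable (hZm n)
    have hlim' : Tendsto (fun n => ∫ ω, clip K (Z n ω) ∂P) atTop (𝓝 (∫ ω, Y ω ∂P)) := by
      refine tendsto_integral_of_dominated_convergence (fun _ => K) hcm (integrable_const K)
        (fun n => ae_of_all _ fun ω => norm_clip_le hK0 _) ?_
      filter_upwards [hlim, hY] with ω h1 h2
      have h3 := ((continuous_clip hK0).tendsto (Y ω)).comp h1
      rwa [clip_of_norm_le hK0 (h2.trans hK)] at h3
    refine le_of_tendsto ((tendsto_const_nhds (x := m)).sub hlim').norm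
      (Eventually.of_forall fun n => ?_)
    have hZ1 : Integrable (Z n) P :=
      ((memLp_two_iff_integrable_sq_norm (hZm n)).mpr (hZi n)).integrable one_le_two
    have hcl : Integrable (fun ω => clip K (Z n ω)) P :=
      Integrable.of_bound (hcm n) K (ae_of_all _ fun ω => norm_clip_le hK0 _)
    rw [← hm n, ← integral_sub hZ1 hcl]
    calc ‖∫ ω, (Z n ω - clip K (Z n ω)) ∂P‖ ≤ ∫ ω, ‖Z n ω‖ ^ 2 / K ∂P :=
          norm_integral_le_of_norm_le ((hZi n).div_const K)
            (ae_of_all _ fun ω => norm_sub_clip_le hK0 _)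
      _ ≤ C / K := by
          rw [integral_div]
          gcongr
          exact hZC n
  have h0 : Tendsto (fun K : ℝ => C / K) atTop (𝓝 0) := tendsto_const_nhds.div_atTop tendsto_id
  have h1 : ‖m - ∫ ω, Y ω ∂P‖ ≤ 0 :=
    ge_of_tendsto h0 ((eventually_ge_atTop 1).mono hbound)
  exact (sub_eq_zero.mp (norm_le_zero_iff.mp h1)).symm

/-! ### The exponential martingale up to the hitting time of a line -/

section Martingale

variable {Ω : Type*} {W : ℝ≥0 → Ω → ℝ} {β u : ℝ} {r lam : ℂ}

/-- The hitting time of the line `2 β y` by the Brownian motion that starts from `u`. -/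
noncomputable def lineHit (W : ℝ≥0 → Ω → ℝ) (β u : ℝ) (ω : Ω) : ℝ≥0∞ :=
  hitTime (lineBoundary β) fun y => brownianFrom W u y ω

/-- The process `exp (-r (B(t) - 2 β t) - λ t)`, a martingale if `λ = r² + 2 β r`. -/
noncomputable def expMart (W : ℝ≥0 → Ω → ℝ) (β u : ℝ) (r lam : ℂ) (t : ℝ≥0) (ω : Ω) : ℂ :=
  cexp (-r * ((brownianFrom W u t ω - 2 * β * t : ℝ) : ℂ) - lam * (t : ℝ))

/-- The factor by which `expMart` changes over a time step `δ` in which the standard Brownian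
motion increases by `x`. -/
noncomputable def expStep (β : ℝ) (r lam : ℂ) (δ : ℝ≥0) (x : ℝ) : ℂ :=
  cexp (-r * ((√2 * x - 2 * β * δ : ℝ) : ℂ) - lam * (δ : ℝ))

/-- The value of `expMart` after `k` steps of size `δ`, stopped at the first grid point at which the
line has been hit. -/
noncomputable def stopped (W : ℝ≥0 → Ω → ℝ) (β u : ℝ) (r lam : ℂ) (δ : ℝ≥0) (k : ℕ) (ω : Ω) : ℂ :=
  expMart W β u r lam (gridStop δ (lineHit W β u ω) k) ω

/-- The value of `expMart` at `t` on the event `{τ > t}`, and `0` elsewhere. -/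
noncomputable def alive (W : ℝ≥0 → Ω → ℝ) (β u : ℝ) (r lam : ℂ) (t : ℝ≥0) : Ω → ℂ :=
  {ω | (t : ℝ≥0∞) < lineHit W β u ω}.indicator (expMart W β u r lam t)

theorem alive_of_lt {t : ℝ≥0} {ω : Ω} (h : (t : ℝ≥0∞) < lineHit W β u ω) :
    alive W β u r lam t ω = expMart W β u r lam t ω :=
  indicator_of_mem (s := {ω | (t : ℝ≥0∞) < lineHit W β u ω}) h _

theorem alive_of_not_lt {t : ℝ≥0} {ω : Ω} (h : ¬ (t : ℝ≥0∞) < lineHit W β u ω) :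
    alive W β u r lam t ω = 0 :=
  indicator_of_notMem (s := {ω | (t : ℝ≥0∞) < lineHit W β u ω}) h _

theorem continuous_brownianFrom {ω : Ω} (h : Continuous (W · ω)) :
    Continuous fun y => brownianFrom W u y ω := by
  unfold brownianFrom; fun_prop

theorem expMart_add (t δ : ℝ≥0) (ω : Ω) :
    expMart W β u r lam (t + δ) ω =
      expMart W β u r lam t ω * expStep β r lam δ (W (t + δ) ω - W t ω) := by
  rw [expMart, expMart, expStep, ← Complex.exp_add]
  congr 1
  simp only [brownianFrom]
  push_cast
  ring

/-- While the hitting time lies ahead, `expMart` is bounded by one. -/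
theorem norm_expMart_le_one (hr : 0 ≤ r.re) (hlam : 0 ≤ lam.re) {ω : Ω} (hω : Continuous (W · ω))
    (h0 : W 0 ω = 0) (hu : 0 < u) {t : ℝ≥0} (ht : (t : ℝ≥0∞) ≤ lineHit W β u ω) :
    ‖expMart W β u r lam t ω‖ ≤ 1 := by
  rw [expMart, norm_exp, Real.exp_le_one_iff, sub_re, re_mul_ofReal, re_mul_ofReal, neg_re]
  have h1 := le_of_le_hitTime (continuous_brownianFrom hω) (by simpa [brownianFrom, h0]) ht
  have h2 : 0 ≤ brownianFrom W u t ω - 2 * β * t := by linarith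
  have h3 : 0 ≤ lam.re * t := by positivity
  nlinarith [mul_nonneg hr h2]

theorem stopped_succ_of_lt {δ : ℝ≥0} {k : ℕ} {ω : Ω}
    (h : ((k * δ : ℝ≥0) : ℝ≥0∞) < lineHit W β u ω) :
    stopped W β u r lam δ (k + 1) ω = alive W β u r lam (k * δ) ω *
      expStep β r lam δ (W (k * δ + δ) ω - W (k * δ) ω) := by
  rw [alive_of_lt h, ← expMart_add, stopped, gridStop, if_pos h, add_mul,
    one_mul]

theorem stopped_of_lt {δ : ℝ≥0} {k : ℕ} {ω : Ω} (h : ((k * δ : ℝ≥0) : ℝ≥0∞) < lineHit W β u ω) :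
    stopped W β u r lam δ k ω = alive W β u r lam (k * δ) ω := by
  rw [alive_of_lt h, stopped, gridStop_of_lt h]

theorem stopped_succ_of_le {δ : ℝ≥0} {k : ℕ} {ω : Ω}
    (h : ¬ ((k * δ : ℝ≥0) : ℝ≥0∞) < lineHit W β u ω) :
    stopped W β u r lam δ (k + 1) ω = stopped W β u r lam δ k ω ∧
      alive W β u r lam (k * δ) ω = 0 := by
  rw [alive_of_not_lt h, stopped, gridStop, if_neg h]
  exact ⟨rfl, rfl⟩

/-- One step of the stopped process: the part that is still alive is multiplied by an independent
factor. -/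
theorem stopped_succ (δ : ℝ≥0) (k : ℕ) (ω : Ω) :
    stopped W β u r lam δ (k + 1) ω = stopped W β u r lam δ k ω +
      (alive W β u r lam (k * δ) ω * expStep β r lam δ (W (k * δ + δ) ω - W (k * δ) ω) -
        alive W β u r lam (k * δ) ω) := by
  by_cases h : ((k * δ : ℝ≥0) : ℝ≥0∞) < lineHit W β u ω
  · rw [stopped_succ_of_lt h, stopped_of_lt h]; ring
  · obtain ⟨h1, h2⟩ := stopped_succ_of_le (r := r) (lam := lam) h
    rw [h1, h2]; ring

theorem norm_stopped_succ_sq (δ : ℝ≥0) (k : ℕ) (ω : Ω) :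
    ‖stopped W β u r lam δ (k + 1) ω‖ ^ 2 = ‖stopped W β u r lam δ k ω‖ ^ 2 +
      (‖alive W β u r lam (k * δ) ω‖ ^ 2 *
        ‖expStep β r lam δ (W (k * δ + δ) ω - W (k * δ) ω)‖ ^ 2 -
          ‖alive W β u r lam (k * δ) ω‖ ^ 2) := by
  by_cases h : ((k * δ : ℝ≥0) : ℝ≥0∞) < lineHit W β u ω
  · rw [stopped_succ_of_lt h, stopped_of_lt h, norm_mul]; ring
  · obtain ⟨h1, h2⟩ := stopped_succ_of_le (r := r) (lam := lam) h
    rw [h1, h2]; simp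

theorem norm_alive_le_norm_stopped (δ : ℝ≥0) (k : ℕ) (ω : Ω) :
    ‖alive W β u r lam (k * δ) ω‖ ≤ ‖stopped W β u r lam δ k ω‖ := by
  by_cases h : ((k * δ : ℝ≥0) : ℝ≥0∞) < lineHit W β u ω
  · rw [stopped_of_lt h]
  · rw [(stopped_succ_of_le (r := r) (lam := lam) h).2, norm_zero]
    exact norm_nonneg _

theorem continuous_expMart {ω : Ω} (h : Continuous (W · ω)) :
    Continuous fun t => expMart W β u r lam t ω := by
  unfold expMart brownianFrom
  fun_prop

variable [MeasurableSpace Ω] {P : Measure Ω}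

theorem continuous_expStep (δ : ℝ≥0) : Continuous (expStep β r lam δ) := by
  unfold expStep; fun_prop

/-- The squared modulus of a step factor is a step factor for the real parameters `2 Re r`,
`2 Re λ`. -/
theorem norm_expStep_sq (δ : ℝ≥0) (x : ℝ) :
    ((‖expStep β r lam δ x‖ ^ 2 : ℝ) : ℂ) = expStep β (2 * r.re : ℝ) (2 * lam.re : ℝ) δ x := by
  rw [expStep, norm_exp, ← Real.exp_nat_mul, expStep, ofReal_exp]
  congr 1
  rw [sub_re, re_mul_ofReal, re_mul_ofReal, neg_re]
  push_cast
  ring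

theorem integral_expStep (δ : ℝ≥0) :
    ∫ x, expStep β r lam δ x ∂gaussianReal 0 δ = cexp ((r ^ 2 + 2 * β * r - lam) * (δ : ℝ)) := by
  have h := complexMGF_id_gaussianReal (μ := 0) (v := δ) (-r * √2)
  have h2 : ((√2 : ℝ) : ℂ) ^ 2 = 2 := by
    rw [← ofReal_pow, Real.sq_sqrt (by norm_num)]; norm_num
  have h3 : ∀ x : ℝ, expStep β r lam δ x =
      cexp ((2 * β * r - lam) * (δ : ℝ)) * cexp (-r * √2 * (id x : ℝ)) := by
    intro x
    rw [expStep, ← Complex.exp_add]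
    congr 1
    push_cast [id]
    ring
  simp_rw [h3]
  rw [integral_const_mul]
  rw [complexMGF] at h
  rw [h, ← Complex.exp_add]
  congr 1
  push_cast
  linear_combination (r ^ 2 * ((δ : ℝ) : ℂ) / 2) * h2

theorem integrable_norm_expStep_sq (δ : ℝ≥0) :
    Integrable (fun x => ‖expStep β r lam δ x‖ ^ 2) (gaussianReal 0 δ) := by
  have h3 : ∀ x : ℝ, ‖expStep β r lam δ x‖ ^ 2 =
      Real.exp ((4 * β * r.re - 2 * lam.re) * δ) * Real.exp (-2 * r.re * √2 * x) := by
    intro x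
    rw [expStep, norm_exp, ← Real.exp_nat_mul, ← Real.exp_add]
    congr 1
    rw [sub_re, re_mul_ofReal, re_mul_ofReal, neg_re]
    push_cast
    ring
  simp_rw [h3]
  exact (integrable_exp_mul_gaussianReal _).const_mul _

theorem integral_norm_expStep_sq_le (δ : ℝ≥0) :
    ∫ x, ‖expStep β r lam δ x‖ ^ 2 ∂gaussianReal 0 δ ≤
      Real.exp (|4 * r.re ^ 2 + 4 * β * r.re - 2 * lam.re| * δ) := by
  have h := integral_expStep (β := β) (r := (2 * r.re : ℝ)) (lam := (2 * lam.re : ℝ)) δ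
  simp_rw [← norm_expStep_sq] at h
  have h' : ∫ x, ‖expStep β r lam δ x‖ ^ 2 ∂gaussianReal 0 δ =
      Real.exp ((4 * r.re ^ 2 + 4 * β * r.re - 2 * lam.re) * δ) := by
    apply ofReal_injective
    refine (integral_ofReal (𝕜 := ℂ)).symm.trans (h.trans ?_)
    push_cast
    ring_nf
  rw [h']
  gcongr
  exact le_abs_self _

theorem aestronglyMeasurable_expMart (hW : IsPreBrownianReal W P) (t : ℝ≥0) :
    AEStronglyMeasurable (expMart W β u r lam t) P := by
  have hc : Continuous fun x : ℝ =>
      cexp (-r * ((u + √2 * x - 2 * β * t : ℝ) : ℂ) - lam * (t : ℝ)) := by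
    fun_prop
  exact (hc.measurable.comp_aemeasurable (hW.aemeasurable t)).aestronglyMeasurable

/-- Up to a null set, `{τ > t}` is an event of the path on `[0, t]`. -/
theorem exists_past_event (hW : IsBrownianReal W P) (β u : ℝ) (t : ℝ≥0) :
    ∃ s : Set (Iic t → ℝ), MeasurableSet s ∧
      ∀ᵐ ω ∂P, (t : ℝ≥0∞) < lineHit W β u ω ↔ (fun q : Iic t => W q ω) ∈ s := by
  refine ⟨{x | ∃ m : ℕ, ∀ n : ℕ, 1 / ((m : ℝ) + 1) ≤
    (u + √2 * x (TopologicalSpace.denseSeq (Iic t) n)) -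
      2 * β * ((TopologicalSpace.denseSeq (Iic t) n : ℝ≥0) : ℝ)}, ?_, ?_⟩
  · simp only [ofPred_exists, ofPred_forall]
    refine MeasurableSet.iUnion fun m => MeasurableSet.iInter fun n => ?_
    exact measurableSet_le measurable_const (by fun_prop)
  · filter_upwards [hW.cont] with ω hω
    exact lt_hitTime_iff_denseSeq (continuous_brownianFrom hω) t

theorem nullMeasurableSet_lt_lineHit (hW : IsBrownianReal W P) (β u : ℝ) (t : ℝ≥0) :
    NullMeasurableSet {ω | (t : ℝ≥0∞) < lineHit W β u ω} P := by
  have h : NullMeasurableSet {ω | ∃ m : ℕ, ∀ n : ℕ, 1 / ((m : ℝ) + 1) ≤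
      (u + √2 * W (TopologicalSpace.denseSeq (Iic t) n) ω) -
        2 * β * ((TopologicalSpace.denseSeq (Iic t) n : ℝ≥0) : ℝ)} P := by
    simp only [ofPred_exists, ofPred_forall]
    refine NullMeasurableSet.iUnion fun m => NullMeasurableSet.iInter fun n => ?_
    exact nullMeasurableSet_le aemeasurable_const
      ((((hW.aemeasurable _).const_mul _).const_add _).sub_const _)
  refine h.congr ?_
  filter_upwards [hW.cont] with ω hω
  exact propext (lt_hitTime_iff_denseSeq (continuous_brownianFrom hω) t).symm

theorem aemeasurable_lineHit (hW : IsBrownianReal W P) (β u : ℝ) :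
    AEMeasurable (lineHit W β u) P := by
  have h : lineHit W β u = fun ω => ⨆ q : ℚ,
      {ω | (Real.toNNReal q : ℝ≥0∞) < lineHit W β u ω}.indicator
        (fun _ => (Real.toNNReal q : ℝ≥0∞)) ω := by
    funext ω
    refine (eq_iSup_indicator _).trans (iSup_congr fun q => ?_)
    rw [indicator_apply]
    rfl
  rw [h]
  exact AEMeasurable.iSup fun q =>
    aemeasurable_const.indicator₀ (nullMeasurableSet_lt_lineHit hW β u _)

/-- Weak Markov property: a functional of the path on `[0, t]` is uncorrelated with a function of
the next increment. -/
theorem integral_past_mul_increment {𝕜 : Type*} [RCLike 𝕜] (hW : IsPreBrownianReal W P)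
    {t δ : ℝ≥0} {f : Ω → 𝕜} {φ : (Iic t → ℝ) → 𝕜} (hφ : Measurable φ)
    (hf : ∀ᵐ ω ∂P, f ω = φ fun q => W q ω) (hfm : AEStronglyMeasurable f P)
    {ψ : ℝ → 𝕜} (hψ : Measurable ψ) :
    ∫ ω, f ω * ψ (W (t + δ) ω - W t ω) ∂P = (∫ ω, f ω ∂P) * ∫ x, ψ x ∂gaussianReal 0 δ := by
  have hlaw := (hW.shift t).hasLaw_eval δ
  have hind : IndepFun f (fun ω => ψ (W (t + δ) ω - W t ω)) P := by
    have h := (hW.indepFun_shift t).symm.comp hφ (hψ.comp (measurable_pi_apply δ))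
    exact h.congr (by filter_upwards [hf] with ω hω using hω.symm) (ae_of_all _ fun _ => rfl)
  rw [hind.integral_fun_mul_eq_mul_integral hfm
    (hψ.comp_aemeasurable hlaw.aemeasurable).aestronglyMeasurable]
  congr 1
  exact hlaw.integral_comp hψ.aestronglyMeasurable

theorem exists_alive_eq (hW : IsBrownianReal W P) (β u : ℝ) (r lam : ℂ) (t : ℝ≥0) :
    ∃ φ : (Iic t → ℝ) → ℂ, Measurable φ ∧ ∀ᵐ ω ∂P, alive W β u r lam t ω = φ fun q => W q ω := by
  obtain ⟨s, hs, hsW⟩ := exists_past_event hW β u t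
  refine ⟨s.indicator fun x => cexp (-r * ((u + √2 * x ⟨t, self_mem_Iic⟩ - 2 * β * t : ℝ) : ℂ) -
    lam * (t : ℝ)), ?_, ?_⟩
  · refine Measurable.indicator ?_ hs
    fun_prop
  · filter_upwards [hsW] with ω hω
    by_cases h : (t : ℝ≥0∞) < lineHit W β u ω
    · rw [alive_of_lt h, indicator_of_mem (hω.mp h)]
      rfl
    · rw [alive_of_not_lt h, indicator_of_notMem (fun h' => h (hω.mpr h'))]

theorem aestronglyMeasurable_alive (hW : IsBrownianReal W P) (t : ℝ≥0) :
    AEStronglyMeasurable (alive W β u r lam t) P :=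
  (aestronglyMeasurable_expMart hW.toIsPreBrownianReal t).indicator₀
    (nullMeasurableSet_lt_lineHit hW β u t)

theorem stopped_zero (hW : IsPreBrownianReal W P) (δ : ℝ≥0) :
    ∀ᵐ ω ∂P, stopped W β u r lam δ 0 ω = cexp (-r * u) := by
  filter_upwards [hW.eval_zero_ae_eq_zero] with ω hω
  simp [stopped, gridStop, expMart, brownianFrom, hω]

theorem norm_alive_le_one (hW : IsBrownianReal W P) (hr : 0 ≤ r.re) (hlam : 0 ≤ lam.re)
    (hu : 0 < u) (t : ℝ≥0) : ∀ᵐ ω ∂P, ‖alive W β u r lam t ω‖ ≤ 1 := by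
  filter_upwards [hW.cont, hW.eval_zero_ae_eq_zero] with ω h1 h2
  by_cases h : (t : ℝ≥0∞) < lineHit W β u ω
  · rw [alive_of_lt h]
    exact norm_expMart_le_one hr hlam h1 h2 hu h.le
  · rw [alive_of_not_lt h, norm_zero]
    exact zero_le_one

theorem aestronglyMeasurable_stopped (hW : IsBrownianReal W P) (δ : ℝ≥0) :
    ∀ k, AEStronglyMeasurable (stopped W β u r lam δ k) P
  | 0 => aestronglyMeasurable_const.congr
      ((stopped_zero hW.toIsPreBrownianReal δ).mono fun _ h => h.symm)
  | k + 1 => by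
      have hinc := ((hW.shift (k * δ)).aemeasurable δ)
      have h := (aestronglyMeasurable_stopped hW δ k).add
        (((aestronglyMeasurable_alive (β := β) (u := u) (r := r) (lam := lam) hW (k * δ)).mul
          ((continuous_expStep (β := β) (r := r) (lam := lam) δ).measurable.comp_aemeasurable
            hinc).aestronglyMeasurable).sub
          (aestronglyMeasurable_alive (β := β) (u := u) (r := r) (lam := lam) hW (k * δ)))
      exact h.congr (ae_of_all _ fun ω => (stopped_succ δ k ω).symm)

theorem integrable_sq_alive_mul_expStep (hW : IsBrownianReal W P) (hr : 0 ≤ r.re)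
    (hlam : 0 ≤ lam.re) (hu : 0 < u) (t δ : ℝ≥0) :
    Integrable (fun ω => ‖alive W β u r lam t ω‖ ^ 2 *
      ‖expStep β r lam δ (W (t + δ) ω - W t ω)‖ ^ 2) P := by
  have hlaw := (hW.shift t).hasLaw_eval δ
  have hstep : Integrable (fun ω => ‖expStep β r lam δ (W (t + δ) ω - W t ω)‖ ^ 2) P := by
    have h := integrable_norm_expStep_sq (β := β) (r := r) (lam := lam) δ
    rw [← hlaw.map_eq] at h
    exact h.comp_aemeasurable hlaw.aemeasurable
  refine hstep.bdd_mul (c := 1) ((aestronglyMeasurable_alive hW t).norm.pow 2) ?_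
  filter_upwards [norm_alive_le_one (β := β) hW hr hlam hu t] with ω hω
  rw [norm_pow, norm_norm]
  exact pow_le_one₀ (norm_nonneg _) hω

theorem integrable_sq_alive (hW : IsBrownianReal W P) [IsFiniteMeasure P] (hr : 0 ≤ r.re)
    (hlam : 0 ≤ lam.re) (hu : 0 < u) (t : ℝ≥0) :
    Integrable (fun ω => ‖alive W β u r lam t ω‖ ^ 2) P := by
  refine Integrable.of_bound ((aestronglyMeasurable_alive hW t).norm.pow 2) 1 ?_
  filter_upwards [norm_alive_le_one (β := β) hW hr hlam hu t] with ω hω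
  rw [norm_pow, norm_norm]
  exact pow_le_one₀ (norm_nonneg _) hω

theorem integrable_sq_stopped (hW : IsBrownianReal W P) [IsFiniteMeasure P] (hr : 0 ≤ r.re)
    (hlam : 0 ≤ lam.re) (hu : 0 < u) (δ : ℝ≥0) :
    ∀ k, Integrable (fun ω => ‖stopped W β u r lam δ k ω‖ ^ 2) P
  | 0 => (integrable_const (‖cexp (-r * u)‖ ^ 2)).congr
      ((stopped_zero hW.toIsPreBrownianReal δ).mono fun _ h => by
        change _ = ‖_‖ ^ 2
        rw [h])
  | k + 1 => by
      simp_rw [norm_stopped_succ_sq]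
      exact (integrable_sq_stopped hW hr hlam hu δ k).add
        ((integrable_sq_alive_mul_expStep hW hr hlam hu _ δ).sub
          (integrable_sq_alive hW hr hlam hu _))

/-- Optional stopping on the grid: the factor that multiplies the part still alive has mean one. -/
theorem integral_stopped (hW : IsBrownianReal W P) [IsProbabilityMeasure P] (hr : 0 ≤ r.re)
    (hlam : 0 ≤ lam.re) (hrl : r ^ 2 + 2 * β * r = lam) (hu : 0 < u) (δ : ℝ≥0) :
    ∀ k, ∫ ω, stopped W β u r lam δ k ω ∂P = cexp (-r * u)
  | 0 => by
      rw [integral_congr_ae (stopped_zero hW.toIsPreBrownianReal δ)]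
      simp
  | k + 1 => by
      have hL2 : ∀ k, Integrable (stopped W β u r lam δ k) P := fun k =>
        ((memLp_two_iff_integrable_sq_norm (aestronglyMeasurable_stopped hW δ k)).mpr
          (integrable_sq_stopped hW hr hlam hu δ k)).integrable one_le_two
      have ha : Integrable (alive W β u r lam (k * δ)) P :=
        Integrable.of_bound (aestronglyMeasurable_alive hW _) 1
          (norm_alive_le_one hW hr hlam hu _)
      obtain ⟨φ, hφ, hφW⟩ := exists_alive_eq hW β u r lam (k * δ)
      have hprod := integral_past_mul_increment (δ := δ) hW.toIsPreBrownianReal hφ hφW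
        (aestronglyMeasurable_alive hW _)
        (continuous_expStep (β := β) (r := r) (lam := lam) δ).measurable
      rw [integral_expStep, hrl, sub_self, zero_mul, Complex.exp_zero, mul_one] at hprod
      have hpi : Integrable (fun ω => alive W β u r lam (k * δ) ω *
          expStep β r lam δ (W (k * δ + δ) ω - W (k * δ) ω)) P := by
        have h := ((hL2 (k + 1)).sub (hL2 k)).add ha
        refine h.congr (ae_of_all _ fun ω => ?_)
        simp only [Pi.add_apply, Pi.sub_apply, stopped_succ]
        ring
      simp_rw [stopped_succ]
      rw [integral_add (hL2 k) (g := fun ω => _ - _) (hpi.sub ha), integral_sub hpi ha, hprod, sub_self, add_zero]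
      exact integral_stopped hW hr hlam hrl hu δ k

/-- Every step increases the second moment of the stopped process by at most the factor
`E |expStep|²`. -/
theorem integral_sq_stopped_le (hW : IsBrownianReal W P) [IsProbabilityMeasure P] (hr : 0 ≤ r.re)
    (hlam : 0 ≤ lam.re) (hu : 0 < u) (δ : ℝ≥0) (k : ℕ) :
    ∫ ω, ‖stopped W β u r lam δ k ω‖ ^ 2 ∂P ≤
      ‖cexp (-r * u)‖ ^ 2 *
        Real.exp (|4 * r.re ^ 2 + 4 * β * r.re - 2 * lam.re| * (k * δ : ℝ≥0)) := by
  set κ := |4 * r.re ^ 2 + 4 * β * r.re - 2 * lam.re| with hκ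
  induction k with
  | zero =>
    have h : ∀ᵐ ω ∂P, ‖stopped W β u r lam δ 0 ω‖ ^ 2 = ‖cexp (-r * u)‖ ^ 2 := by
      filter_upwards [stopped_zero (β := β) (u := u) (r := r) (lam := lam)
        hW.toIsPreBrownianReal δ] with ω hω
      rw [hω]
    rw [integral_congr_ae h]
    simp
  | succ k ih =>
    have hs := integrable_sq_stopped (β := β) hW hr hlam hu δ k
    have ha := integrable_sq_alive (β := β) hW hr hlam hu (k * δ)
    have hp := integrable_sq_alive_mul_expStep (β := β) hW hr hlam hu (k * δ) δ
    obtain ⟨φ, hφ, hφW⟩ := exists_alive_eq hW β u r lam (k * δ)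
    have hprod := integral_past_mul_increment (𝕜 := ℝ) (δ := δ) hW.toIsPreBrownianReal
      (f := fun ω => ‖alive W β u r lam (k * δ) ω‖ ^ 2) (φ := fun x => ‖φ x‖ ^ 2) (hφ.norm.pow_const 2)
      (by filter_upwards [hφW] with ω hω; rw [hω]) ha.aestronglyMeasurable
      (ψ := fun x => ‖expStep β r lam δ x‖ ^ 2)
      ((continuous_expStep (β := β) (r := r) (lam := lam) δ).norm.pow 2).measurable
    simp_rw [norm_stopped_succ_sq]
    rw [integral_add hs (g := fun ω => _ - _) (hp.sub ha), integral_sub hp ha, hprod]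
    have hle : ∫ ω, ‖alive W β u r lam (k * δ) ω‖ ^ 2 ∂P ≤
        ∫ ω, ‖stopped W β u r lam δ k ω‖ ^ 2 ∂P := by
      refine integral_mono ha hs fun ω => ?_
      have := norm_alive_le_norm_stopped (W := W) (β := β) (u := u) (r := r) (lam := lam) δ k ω
      dsimp only
      gcongr
    have hstep := integral_norm_expStep_sq_le (β := β) (r := r) (lam := lam) δ
    rw [← hκ] at hstep
    have hone : 1 ≤ Real.exp (κ * δ) := Real.one_le_exp (by positivity)
    have hsplit : Real.exp (κ * (((k + 1 : ℕ) * δ : ℝ≥0) : ℝ)) =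
        Real.exp (κ * ((k * δ : ℝ≥0) : ℝ)) * Real.exp (κ * δ) := by
      rw [← Real.exp_add]; congr 1; push_cast; ring
    rw [hsplit, ← mul_assoc]
    have ha0 : 0 ≤ ∫ ω, ‖alive W β u r lam (k * δ) ω‖ ^ 2 ∂P :=
      integral_nonneg fun _ => by positivity
    set a := ∫ ω, ‖alive W β u r lam (k * δ) ω‖ ^ 2 ∂P
    set d := ∫ ω, ‖stopped W β u r lam δ k ω‖ ^ 2 ∂P
    calc d + (a * ∫ x, ‖expStep β r lam δ x‖ ^ 2 ∂gaussianReal 0 δ - a)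
        ≤ d + (a * Real.exp (κ * δ) - a) := by gcongr
      _ = d + a * (Real.exp (κ * δ) - 1) := by ring
      _ ≤ d + d * (Real.exp (κ * δ) - 1) := by
          gcongr
      _ = d * Real.exp (κ * δ) := by ring
      _ ≤ _ := by gcongr

theorem coe_toNNReal_min (τ : ℝ≥0∞) (T : ℝ≥0) :
    ((min τ T).toNNReal : ℝ≥0∞) = min τ T :=
  ENNReal.coe_toNNReal ((min_le_right _ _).trans_lt ENNReal.coe_lt_top).ne

/-- Optional stopping of `expMart` at the minimum of the hitting time and `T`. -/
theorem integral_expMart_min (hW : IsBrownianReal W P) [IsProbabilityMeasure P] (hr : 0 ≤ r.re)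
    (hlam : 0 ≤ lam.re) (hrl : r ^ 2 + 2 * β * r = lam) (hu : 0 < u) (T : ℝ≥0) :
    ∫ ω, expMart W β u r lam (min (lineHit W β u ω) T).toNNReal ω ∂P = cexp (-r * u) := by
  have hT : ∀ N : ℕ, ((N + 1 : ℕ) : ℝ≥0) * (T / (N + 1)) = T := by
    intro N
    have : (N : ℝ≥0) + 1 ≠ 0 := by positivity
    push_cast
    field_simp
  -- the time horizon `T` stays fixed while the mesh `T / (N + 1)` tends to zero
  refine integral_eq_of_tendsto_of_sq_bound
    (Z := fun N => stopped W β u r lam (T / (N + 1)) (N + 1))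
    (fun N => aestronglyMeasurable_stopped hW _ _)
    (fun N => integrable_sq_stopped hW hr hlam hu _ _)
    (C := ‖cexp (-r * u)‖ ^ 2 * Real.exp (|4 * r.re ^ 2 + 4 * β * r.re - 2 * lam.re| * T))
    (fun N => ?_) (fun N => integral_stopped hW hr hlam hrl hu _ _) ?_ ?_
  · have h := integral_sq_stopped_le (β := β) hW hr hlam hu (T / (N + 1)) (N + 1)
    rwa [hT] at h
  · filter_upwards [hW.cont, hW.eval_zero_ae_eq_zero] with ω h1 h2
    refine norm_expMart_le_one hr hlam h1 h2 hu ?_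
    rw [coe_toNNReal_min]
    exact min_le_left _ _
  · filter_upwards [hW.cont] with ω h1
    exact ((continuous_expMart h1).tendsto _).comp (tendsto_gridStop T _)

/-- The Laplace transform of the hitting time: `E [e^{-λ τ}; τ < ∞] = e^{-r u}` if
`λ = r² + 2 β r`. -/
theorem integral_exp_lineHit (hW : IsBrownianReal W P) [IsProbabilityMeasure P] (hr : 0 ≤ r.re)
    (hlam : 0 < lam.re) (hrl : r ^ 2 + 2 * β * r = lam) (hu : 0 < u) :
    ∫ ω, {ω | lineHit W β u ω < ∞}.indicator
      (fun ω => cexp (-lam * (lineHit W β u ω).toReal)) ω ∂P = cexp (-r * u) := by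
  have hmeas : ∀ T : ℝ≥0, AEStronglyMeasurable
      (fun ω => expMart W β u r lam (min (lineHit W β u ω) T).toNNReal ω) P := by
    intro T
    refine aestronglyMeasurable_of_tendsto_ae atTop
      (f := fun N : ℕ => stopped W β u r lam (T / (N + 1)) (N + 1))
      (fun N => aestronglyMeasurable_stopped hW _ _) ?_
    filter_upwards [hW.cont] with ω h1
    exact ((continuous_expMart h1).tendsto _).comp (tendsto_gridStop T _)
  have hlim := tendsto_integral_of_dominated_convergence (μ := P)
    (F := fun (n : ℕ) ω => expMart W β u r lam (min (lineHit W β u ω) (n : ℝ≥0)).toNNReal ω)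
    (f := {ω | lineHit W β u ω < ∞}.indicator
      (fun ω => cexp (-lam * (lineHit W β u ω).toReal)))
    (fun _ => 1) (fun n => hmeas n) (integrable_const 1) (fun n => by
      filter_upwards [hW.cont, hW.eval_zero_ae_eq_zero] with ω h1 h2
      refine norm_expMart_le_one hr hlam.le h1 h2 hu ?_
      rw [coe_toNNReal_min]
      exact min_le_left _ _) (by
      filter_upwards [hW.cont, hW.eval_zero_ae_eq_zero] with ω h1 h2
      have hB0 : 0 < brownianFrom W u 0 ω := by simpa [brownianFrom, h2]
      by_cases h : lineHit W β u ω < ∞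
      · rw [indicator_of_mem (s := {ω | lineHit W β u ω < ∞}) h]
        refine tendsto_const_nhds.congr' ?_
        obtain ⟨n, hn⟩ := ENNReal.exists_nat_gt h.ne
        filter_upwards [eventually_ge_atTop n] with k hk
        have hle : lineHit W β u ω ≤ ((k : ℝ≥0) : ℝ≥0∞) := by
          refine hn.le.trans ?_
          exact_mod_cast hk
        have happ := apply_hitTime (β := β) (continuous_brownianFrom h1) hB0 h
        rw [← lineHit] at happ
        rw [min_eq_left hle, expMart, happ, sub_self, ofReal_zero, mul_zero, zero_sub,
          ENNReal.coe_toNNReal_eq_toReal, neg_mul]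
      · rw [indicator_of_notMem (s := {ω | lineHit W β u ω < ∞}) h]
        have htop : lineHit W β u ω = ∞ := not_lt_top_iff.mp h
        refine squeeze_zero_norm (a := fun n : ℕ => Real.exp (-(lam.re * n))) (fun n => ?_) ?_
        · rw [htop, min_eq_right le_top, ENNReal.toNNReal_coe, expMart, norm_exp]
          refine Real.exp_le_exp.mpr ?_
          rw [sub_re, re_mul_ofReal, re_mul_ofReal, neg_re]
          have h3 : 2 * β * ((n : ℝ≥0) : ℝ) ≤ brownianFrom W u n ω :=
            le_of_le_hitTime (continuous_brownianFrom h1) hB0 (by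
              rw [lineHit] at htop
              rw [htop]
              exact le_top)
          have h4 := mul_nonneg hr (sub_nonneg.mpr h3)
          push_cast at h4 ⊢
          linarith
        · exact Real.tendsto_exp_neg_atTop_nhds_zero.comp
            (tendsto_natCast_atTop_atTop.const_mul_atTop hlam))
  simp_rw [integral_expMart_min hW hr hlam.le hrl hu] at hlim
  exact (tendsto_nhds_unique tendsto_const_nhds hlim).symm

end Martingale

/-! ### The kernel of the hitting operator -/

section Kernel

variable {Ω : Type*} {W : ℝ≥0 → Ω → ℝ} {β u v : ℝ}

/-- The contour for the hitting operator. For `p` on it, `λ = p² - 2 β p` has positive real part and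
`r = p - 2 β`, which solves `r² + 2 β r = λ`, has nonnegative real part. -/
noncomputable def hitContour (β s : ℝ) : ℂ := diag (β + |β| + 1) s

/-- The Laplace variable `λ = p² - 2 β p` at the point `p` of the contour with parameter `s`. -/
noncomputable def laplaceVar (β s : ℝ) : ℂ := hitContour β s ^ 2 - 2 * β * hitContour β s

theorem continuous_hitContour (β : ℝ) : Continuous (hitContour β) := continuous_diag _

theorem continuous_laplaceVar (β : ℝ) : Continuous (laplaceVar β) := by
  have := continuous_hitContour β
  unfold laplaceVar
  fun_prop

theorem hitContour_re (β s : ℝ) : (hitContour β s).re = β + |β| + 1 + s := by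
  simp [hitContour, diag]

theorem hitContour_im (β s : ℝ) : (hitContour β s).im = s := by
  simp [hitContour, diag]

theorem laplaceVar_re_pos {s : ℝ} (hs : 0 ≤ s) : 0 < (laplaceVar β s).re := by
  have h : (laplaceVar β s).re = 2 * |β| + 1 + 2 * s * (|β| + 1) := by
    rw [laplaceVar, sub_re, pow_two, mul_re, hitContour_re, hitContour_im]
    have h2 : (2 * (β : ℂ) * hitContour β s).re = 2 * β * (β + |β| + 1 + s) := by
      rw [← hitContour_re]; simp
    rw [h2]
    nlinarith [sq_abs β]
  rw [h]
  positivity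

/-- Completing the cube: the prefactor of `S_{-τ}(2 β τ, v)` is absorbed if the contour of the Airy
function is shifted by `τ`. -/
theorem exp_mul_airyExp_shift (β v τ : ℝ) (p : ℂ) :
    ((Real.exp (2 / 3 * (0 - τ) ^ 3 + (0 - τ) * (v - 2 * β * τ)) : ℝ) : ℂ) *
        airyExp (v - 2 * β * τ + (0 - τ) ^ 2) (p - τ) =
      airyExp v p * cexp (-(p ^ 2 - 2 * β * p) * τ) := by
  rw [airyExp, airyExp, ofReal_exp, ← Complex.exp_add, ← Complex.exp_add]
  congr 1
  push_cast
  ring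

theorem S_eq_im_integral (β v τ : ℝ) :
    S (0 - τ) (2 * β * τ) v =
      (∫ s in Ioi (0 : ℝ), airyExp v (hitContour β s) * (1 + I) *
        cexp (-laplaceVar β s * τ)).im / Real.pi := by
  rw [S, airy_eq_im_diagIntegral (β + |β| + 1 - τ), ← mul_div_assoc, diagIntegral,
    ← im_ofReal_mul, ← integral_const_mul]
  congr 3
  funext s
  have hd : diag (β + |β| + 1 - τ) s = hitContour β s - τ := by
    simp only [hitContour, diag]; push_cast; ring
  rw [hd, ← mul_assoc, exp_mul_airyExp_shift, laplaceVar]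
  ring

/-- The reflection: multiplying `e^{p³/3 - v p}` by the Laplace transform `e^{-(p - 2 β) u}` shifts
`v` to `v + u`. -/
theorem airyExp_mul_exp (β u v : ℝ) (p : ℂ) :
    airyExp v p * cexp (-(p - 2 * β) * u) = (Real.exp (2 * β * u) : ℝ) * airyExp (v + u) p := by
  rw [airyExp, airyExp, ofReal_exp, ← Complex.exp_add, ← Complex.exp_add]
  congr 1
  push_cast
  ring

/-- The joint integrand in the contour parameter `s` and the path `ω`. -/
noncomputable def jointIntegrand (W : ℝ≥0 → Ω → ℝ) (β u v s : ℝ) (ω : Ω) : ℂ :=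
  airyExp v (hitContour β s) * (1 + I) *
    {ω | lineHit W β u ω < ∞}.indicator
      (fun ω => cexp (-laplaceVar β s * (lineHit W β u ω).toReal)) ω

theorem hypoIntegrand_eq {ω : Ω} (hω : Continuous (W · ω)) (h0 : W 0 ω = 0) (hu : 0 < u) :
    hypoIntegrand W (lineBoundary β) 0 u v ω =
      (∫ s in Ioi (0 : ℝ), jointIntegrand W β u v s ω).im / Real.pi := by
  have hdef : hypoIntegrand W (lineBoundary β) 0 u v ω =
      open Classical in
      if lineHit W β u ω < ∞ then S (0 - (lineHit W β u ω).toReal)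
        (brownianFrom W u (lineHit W β u ω).toNNReal ω) v else 0 := rfl
  rw [hdef]
  by_cases h : lineHit W β u ω < ∞
  · have happ : brownianFrom W u (lineHit W β u ω).toNNReal ω =
        2 * β * (lineHit W β u ω).toReal :=
      apply_hitTime (continuous_brownianFrom hω) (by simpa [brownianFrom, h0]) h
    rw [if_pos h, happ, S_eq_im_integral]
    simp only [jointIntegrand]
    congr 3
    funext s
    rw [indicator_of_mem (s := {ω | lineHit W β u ω < ∞}) h]
  · rw [if_neg h]
    have hz : ∀ s, jointIntegrand W β u v s ω = 0 := fun s => by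
      rw [jointIntegrand, indicator_of_notMem (s := {ω | lineHit W β u ω < ∞}) h, mul_zero]
    simp [hz]

variable [MeasurableSpace Ω] {P : Measure Ω}

theorem integrable_jointIntegrand (hW : IsBrownianReal W P) [IsProbabilityMeasure P]
    (β u v : ℝ) :
    Integrable (fun q : Ω × ℝ => jointIntegrand W β u v q.2 q.1)
      (P.prod (volume.restrict (Ioi 0))) := by
  have hτ : AEMeasurable (fun q : Ω × ℝ => (q.2, lineHit W β u q.1))
      (P.prod (volume.restrict (Ioi 0))) :=
    measurable_snd.aemeasurable.prodMk (aemeasurable_lineHit hW β u).comp_fst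
  have hg : Measurable fun x : ℝ × ℝ≥0∞ => airyExp v (hitContour β x.1) * (1 + I) *
      {x : ℝ × ℝ≥0∞ | x.2 < ∞}.indicator (fun x => cexp (-laplaceVar β x.1 * x.2.toReal)) x := by
    have h1 : Measurable fun x : ℝ × ℝ≥0∞ => airyExp v (hitContour β x.1) :=
      ((continuous_airyExp v).comp (continuous_hitContour β)).measurable.comp measurable_fst
    have h2 : Measurable fun x : ℝ × ℝ≥0∞ => laplaceVar β x.1 :=
      (continuous_laplaceVar β).measurable.comp measurable_fst
    have h3 : Measurable fun x : ℝ × ℝ≥0∞ => ((x.2.toReal : ℝ) : ℂ) :=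
      measurable_ofReal.comp measurable_snd.ennreal_toReal
    exact (h1.mul_const _).mul ((((h2.neg).mul h3).cexp).indicator
      (measurableSet_lt measurable_snd measurable_const))
  have hdom : Integrable (fun q : Ω × ℝ => airyExp v (hitContour β q.2) * (1 + I))
      (P.prod (volume.restrict (Ioi 0))) :=
    (integrableOn_airyExp_diag v (β + |β| + 1)).comp_snd P
  refine hdom.mono (hg.comp_aemeasurable hτ).aestronglyMeasurable ?_
  have hpos : ∀ᵐ q : Ω × ℝ ∂P.prod (volume.restrict (Ioi 0)), (0 : ℝ) < q.2 :=
    Measure.quasiMeasurePreserving_snd.ae (ae_restrict_mem measurableSet_Ioi)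
  filter_upwards [hpos] with q hq
  rw [jointIntegrand, norm_mul]
  refine mul_le_of_le_one_right (norm_nonneg _) ((norm_indicator_le_norm_self _ _).trans ?_)
  rw [norm_exp, Real.exp_le_one_iff, re_mul_ofReal, neg_re]
  have h1 := (laplaceVar_re_pos (β := β) hq.le).le
  have h2 : 0 ≤ (lineHit W β u q.1).toReal := ENNReal.toReal_nonneg
  nlinarith [mul_nonneg h1 h2]

theorem integrable_hypoIntegrand_of_pos (hW : IsBrownianReal W P) [IsProbabilityMeasure P]
    (β v : ℝ) (hu : 0 < u) : Integrable (hypoIntegrand W (lineBoundary β) 0 u v) P := by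
  have h := ((integrable_jointIntegrand hW β u v).integral_prod_left.im).div_const Real.pi
  refine h.congr ?_
  filter_upwards [hW.cont, hW.eval_zero_ae_eq_zero] with ω h1 h2
  exact (hypoIntegrand_eq h1 h2 hu).symm

/-- The hitting kernel above the line, by Fubini's theorem and the Laplace transform of the hitting
time. -/
theorem hypoKernel_of_pos (hW : IsBrownianReal W P) [IsProbabilityMeasure P]
    (β v : ℝ) (hu : 0 < u) :
    hypoKernel P W (lineBoundary β) 0 u v = Real.exp (2 * β * u) * airy (v + u) := by
  have hint := integrable_jointIntegrand hW β u v
  have hae : hypoIntegrand W (lineBoundary β) 0 u v =ᵐ[P]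
      fun ω => imCLM (∫ s in Ioi (0 : ℝ), jointIntegrand W β u v s ω) / Real.pi := by
    filter_upwards [hW.cont, hW.eval_zero_ae_eq_zero] with ω h1 h2
    exact hypoIntegrand_eq h1 h2 hu
  have hinner : ∀ s ∈ Ioi (0 : ℝ), ∫ ω, jointIntegrand W β u v s ω ∂P =
      (Real.exp (2 * β * u) : ℝ) *
        (airyExp (v + u) (diag (β + |β| + 1) s) * (1 + I)) := by
    intro s hs
    have hs0 : 0 < s := hs
    have hl := integral_exp_lineHit (β := β) (r := hitContour β s - 2 * β)
      (lam := laplaceVar β s) hW (by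
        have h2 : (2 * (β : ℂ)).re = 2 * β := by simp
        rw [sub_re, hitContour_re, h2]
        have := le_abs_self β
        linarith) (laplaceVar_re_pos hs0.le) (by rw [laplaceVar]; ring) hu
    simp only [jointIntegrand]
    rw [integral_const_mul, hl, mul_right_comm, airyExp_mul_exp, mul_assoc, hitContour]
  rw [hypoKernel, integral_congr_ae hae, integral_div,
    imCLM.integral_comp_comm hint.integral_prod_left,
    integral_integral_swap (f := fun ω s => jointIntegrand W β u v s ω) hint,
    setIntegral_congr_fun measurableSet_Ioi hinner, integral_const_mul,
    airy_eq_im_diagIntegral (β + |β| + 1), ← mul_div_assoc, ← im_ofReal_mul]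
  rfl

/-- Below the line the hitting time is zero. -/
theorem hypoIntegrand_of_nonpos (hW : IsBrownianReal W P) (β v : ℝ) (hu : u ≤ 0) :
    hypoIntegrand W (lineBoundary β) 0 u v =ᵐ[P] fun _ => S 0 u v := by
  filter_upwards [hW.eval_zero_ae_eq_zero] with ω hω
  have hb : brownianFrom W u 0 ω = u := by simp [brownianFrom, hω]
  have hτ : hitTime (lineBoundary β) (fun y => brownianFrom W u y ω) = 0 := by
    have h := hitTime_lineBoundary_le (β := β) (b := fun y => brownianFrom W u y ω) (t := 0)
      (by simpa [hb] using hu)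
    simpa using h
  simp [hypoIntegrand, hτ, hb]

theorem S_zero (u v : ℝ) : S 0 u v = airy (v - u) := by
  simp [S]

/-- The factor in front of the reflected kernel is `e^{2βu}`: it collects `e^{βu}` from `M β` and
`e^{-β(-u)}` from `M (-β)` at the reflected point. -/
theorem reflection_apply (β u : ℝ) (g : ℝ → ℝ) :
    (χ 0 * (M β * R * M (-β))) g u + χbar 0 g u =
      if 0 < u then Real.exp (2 * β * u) * g (-u) else g u := by
  have hχ : (χ 0 * (M β * R * M (-β))) g u =
      if 0 < u then Real.exp (β * u) * (Real.exp (-β * -u) * g (-u)) else 0 := rfl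
  have hχbar : χbar 0 g u = g u - if 0 < u then g u else 0 := rfl
  rw [hχ, hχbar]
  split_ifs
  · rw [sub_self, add_zero, ← mul_assoc, ← Real.exp_add]
    ring_nf
  · ring

theorem hypoKernel_lineBoundary (hW : IsBrownianReal W P) (β u v : ℝ) :
    Integrable (hypoIntegrand W (lineBoundary β) 0 u v) P ∧
      hypoKernel P W (lineBoundary β) 0 u v =
        if 0 < u then Real.exp (2 * β * u) * S 0 (-u) v else S 0 u v := by
  have : IsProbabilityMeasure P := hW.isGaussianProcess.isProbabilityMeasure
  split_ifs with hu
  · refine ⟨integrable_hypoIntegrand_of_pos hW β v hu, ?_⟩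
    rw [hypoKernel_of_pos hW β v hu, S_zero, sub_neg_eq_add]
  · have h := hypoIntegrand_of_nonpos hW β v (not_lt.mp hu)
    refine ⟨(integrable_const _).congr h.symm, ?_⟩
    rw [hypoKernel, integral_congr_ae h]
    simp

end Kernel

end HitOp

theorem lemma4p2 {Ω : Type*} [MeasurableSpace Ω] (P : Measure Ω) (W : ℝ≥0 → Ω → ℝ)
    (hW : IsBrownianReal W P) (β : ℝ) :
    -- the expectation that defines the kernel exists, and the kernels agree
    (∀ u v : ℝ,
      Integrable (HitOp.hypoIntegrand W (HitOp.lineBoundary β) 0 u v) P ∧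
      HitOp.hypoKernel P W (HitOp.lineBoundary β) 0 u v =
        (HitOp.χ 0 * (HitOp.M β * HitOp.R * HitOp.M (-β))) (fun u' => HitOp.S 0 u' v) u +
          HitOp.χbar 0 (fun u' => HitOp.S 0 u' v) u) ∧
    -- the operators are defined on L²(a, ∞) and agree there
    (∀ (a : ℝ) (f : ℝ → ℝ), MemLp f 2 (volume.restrict (Ioi a)) →
      (∀ u : ℝ, IntegrableOn (fun v => HitOp.S 0 u v * f v) (Ioi a)) ∧
      (∀ u : ℝ, IntegrableOn
        (fun v => HitOp.hypoKernel P W (HitOp.lineBoundary β) 0 u v * f v) (Ioi a)) ∧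
      HitOp.kernelOp (HitOp.hypoKernel P W (HitOp.lineBoundary β) 0) a f =
        (HitOp.χ 0 * (HitOp.M β * HitOp.R * HitOp.M (-β))) (HitOp.kernelOp (HitOp.S 0) a f) +
          HitOp.χbar 0 (HitOp.kernelOp (HitOp.S 0) a f)) := by
  have hK : ∀ u v, HitOp.hypoKernel P W (HitOp.lineBoundary β) 0 u v =
      if 0 < u then Real.exp (2 * β * u) * HitOp.S 0 (-u) v else HitOp.S 0 u v :=
    fun u v => (HitOp.hypoKernel_lineBoundary hW β u v).2
  refine ⟨fun u v => ⟨(HitOp.hypoKernel_lineBoundary hW β u v).1, ?_⟩, fun a f hf => ?_⟩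
  · rw [hK, HitOp.reflection_apply]
  have hS : ∀ u : ℝ, IntegrableOn (fun v => HitOp.S 0 u v * f v) (Ioi a) := by
    intro u
    simp_rw [HitOp.S_zero]
    exact HitOp.integrableOn_airy_sub_mul hf u
  refine ⟨hS, fun u => ?_, ?_⟩
  · simp_rw [hK]
    split_ifs
    · simp_rw [mul_assoc]
      exact (hS (-u)).const_mul _
    · exact hS u
  · funext u
    rw [Pi.add_apply, HitOp.reflection_apply]
    simp only [HitOp.kernelOp, hK]
    split_ifs
    · simp_rw [mul_assoc]
      rw [integral_const_mul, ← mul_assoc]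
    · rfl
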